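/- Let $D\ge 3$ be an integer, let $w$ denote the Hamming weight on $\mathbb F_2^D$, and let $X=\{y\in\mathbb F_2^D : w(y)\text{ even}\}$. The halved cube $\frac12 H(D,2)$ is the graph with vertex set $X$ in which $y,z\in X$ are adjacent if and only if $w(y-z)=2$; let $A\in\mathrm{Mat}_X(\mathbb C)$ be its adjacency matrix. Fix $x\in X$, let $A^*\in\mathrm{Mat}_X(\mathbb C)$ be the diagonal matrix with $A^*_{yy}=D-2w(x-y)$ for $y\in X$, and let $\mathcal T=\mathcal T(x)$ (the Terwilliger algebra) be the unital subalgebra of $\mathrm{Mat}_X(\mathbb C)$ generated by $A$ and $A^*$. It acts on the standard module $\mathbb C^X$ by matrix-vector multiplication. For every even integer $k$ with $0\le k\le\lfloor D/2\rfloor$ there is an irreducible $\mathcal T$-module $M_k$ of dimension $\lfloor D/2\rfloor-k+1$ that has a basis $(v_i)_{0\le i\le \lfloor D/2\rfloor-k}$ with $$A v_i=\beta_i v_{i+1}+\alpha_i v_i+\gamma_i v_{i-1},\qquad A^*v_i=(D-2(2i+k))\,v_i$$ (where $v_j=0$ for indices $j$ out of range), with $\alpha_i=2i(D-2i-2k)-k$,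 $\beta_i=(i+1)(2i+1)$, $\gamma_i=\frac12(D-2i-2k+1)(D-2i-2k+2)$. For every even integer $k$ with $2\le k\le\lceil D/2\rceil$ there is an irreducible $\mathcal T$-module $N_k$ of dimension $\lceil D/2\rceil-k+1$ that has a basis $(v_i)_{0\le i\le \lceil D/2\rceil-k}$ for which the same displayed formulas hold with $\alpha_i=(2i+1)(D-2i-2k+1)-k+1$, $\beta_i=(i+1)(2i+3)$, $\gamma_i=\frac12(D-2i-2k+2)(D-2i-2k+3)$. For all $k$ in the respective ranges the numbers $\frac{D-2k+1}{D-k+1}\binom Dk$ and $\frac{D-2k+3}{D-k+2}\binom D{k-1}$ are natural numbers, and for any choice of modules $M_k$, $N_k$ as above the standard $\mathcal T$-module $\mathbb C^X$ is isomorphic, as a $\mathcal T$-module, to $$\bigoplus_{\substack{0\le k\le\lfloor D/2\rfloor\\ k\text{ even}}}\frac{D-2k+1}{D-k+1}\binom Dk\cdot M_k\;\oplus\;\bigoplus_{\substack{2\le k\le\lceil D/2\rceil\\ k\text{ even}}}\frac{D-2k+3}{D-k+2}\binom D{k-1}\cdot N_k,$$ where $p\cdot V$ denotes the direct sum of $p$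 copies of $V$. -/

import Mathlib

open scoped DirectSum

namespace HalvedCube

/-- The vertex set `X`: the vectors of even Hamming weight in `𝔽₂^D`. -/
abbrev X (D : ℕ) : Type := {y : Fin D → ZMod 2 // Even (hammingNorm y)}

/-- The halved cube `½H(D,2)`: two vertices are adjacent iff their difference has weight `2`. -/
def graph (D : ℕ) : SimpleGraph (X D) where
  Adj y z := hammingNorm (y.1 - z.1) = 2
  symm := ⟨fun y z h => by
    simpa only [← neg_sub y.1 z.1, hammingNorm, Pi.neg_apply, ne_eq, neg_eq_zero] using h⟩
  loopless := ⟨fun y h => by simp at h⟩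

instance (D : ℕ) : DecidableRel (graph D).Adj :=
  fun y z => inferInstanceAs (Decidable (hammingNorm (y.1 - z.1) = 2))

/-- The adjacency matrix `A` of the halved cube. -/
def A (D : ℕ) : Matrix (X D) (X D) ℂ := (graph D).adjMatrix ℂ

/-- The dual adjacency matrix `A* = A*(x)`: diagonal, with `A*_{yy} = D - 2 w(x - y)`. -/
def Astar (D : ℕ) (x : X D) : Matrix (X D) (X D) ℂ :=
  Matrix.diagonal fun y => (D : ℂ) - 2 * (hammingNorm (x.1 - y.1) : ℂ)

/-- The Terwilliger algebra `T = T(x)` of the halved cube: the unital subalgebra of `Mat_X(ℂ)`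
generated by `A` and `A*(x)`. Its standard module is `X D → ℂ`, on which it acts by
matrix-vector multiplication (the action that `Matrix (X D) (X D) ℂ` has in Mathlib). -/
abbrev T (D : ℕ) (x : X D) : Subalgebra ℂ (Matrix (X D) (X D) ℂ) :=
  Algebra.adjoin ℂ {A D, Astar D x}

/-- The action of `T` on the standard module is matrix-vector multiplication. -/
theorem smul_standard (D : ℕ) (x : X D) (t : T D x) (v : X D → ℂ) : t • v = t.1.mulVec v := rfl

/-- `A` as an element of `T`. -/
def genA (D : ℕ) (x : X D) : T D x := ⟨A D, Algebra.subset_adjoin (by simp)⟩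

/-- `A*` as an element of `T`. -/
def genAstar (D : ℕ) (x : X D) : T D x := ⟨Astar D x, Algebra.subset_adjoin (by simp)⟩

/-- The tridiagonal matrix of size `n` with diagonal entries `α 0, …, α (n-1)`, subdiagonal
entries `β 0, …, β (n-2)` (entry `(i+1, i)` is `β i`) and superdiagonal entries
`γ 1, …, γ (n-1)` (entry `(i, i+1)` is `γ (i+1)`). -/
def tridiag (n : ℕ) (α β γ : ℕ → ℂ) : Matrix (Fin n) (Fin n) ℂ :=
  Matrix.of fun i j =>
    if (i : ℕ) = j then α j
    else if (i : ℕ) = j + 1 then β j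
    else if (j : ℕ) = i + 1 then γ j
    else 0

/-- The matrix that represents `A` on `M_k`; it has size `⌊D/2⌋ - k + 1`. -/
noncomputable def matM (D k : ℕ) : Matrix (Fin (D / 2 - k + 1)) (Fin (D / 2 - k + 1)) ℂ :=
  tridiag (D / 2 - k + 1)
    (fun i => 2 * (i : ℂ) * ((D : ℂ) - 2 * i - 2 * k) - k)
    (fun i => ((i : ℂ) + 1) * (2 * i + 1))
    (fun i => 1 / 2 * ((D : ℂ) - 2 * i - 2 * k + 1) * ((D : ℂ) - 2 * i - 2 * k + 2))

/-- The matrix that represents `A` on `N_k`; it has size `⌈D/2⌉ - k + 1`. -/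
noncomputable def matN (D k : ℕ) : Matrix (Fin ((D + 1) / 2 - k + 1)) (Fin ((D + 1) / 2 - k + 1)) ℂ :=
  tridiag ((D + 1) / 2 - k + 1)
    (fun i => (2 * (i : ℂ) + 1) * ((D : ℂ) - 2 * i - 2 * k + 1) - k + 1)
    (fun i => ((i : ℂ) + 1) * (2 * i + 3))
    (fun i => 1 / 2 * ((D : ℂ) - 2 * i - 2 * k + 2) * ((D : ℂ) - 2 * i - 2 * k + 3))

/-- The diagonal matrix `diag(D - 2k, D - 2(2 + k), D - 2(4 + k), …)` of size `n`, which
represents `A*` on `M_k` and on `N_k` (for the respective sizes `n`). -/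
def matStar (D k n : ℕ) : Matrix (Fin n) (Fin n) ℂ :=
  Matrix.diagonal fun i => (D : ℂ) - 2 * (2 * (i : ℕ) + k)

section Modules

variable (D : ℕ) (x : X D) (k : ℕ) (W : Type*) [AddCommGroup W] [Module ℂ W]
  [Module (T D x) W] [IsScalarTower ℂ (T D x) W]

/-- The `T`-module `W` is (a copy of) `M_k`: it is irreducible and has a basis with `⌊D/2⌋ - k + 1`
elements with respect to which `A` and `A*` are represented by the prescribed matrices. -/
def IsM : Prop :=
  IsSimpleModule (T D x) W ∧
    ∃ b : Module.Basis (Fin (D / 2 - k + 1)) ℂ W,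
      LinearMap.toMatrix b b (Algebra.lsmul ℂ ℂ W (genA D x)) = matM D k ∧
      LinearMap.toMatrix b b (Algebra.lsmul ℂ ℂ W (genAstar D x)) = matStar D k (D / 2 - k + 1)

/-- The `T`-module `W` is (a copy of) `N_k`: it is irreducible and has a basis with `⌈D/2⌉ - k + 1`
elements with respect to which `A` and `A*` are represented by the prescribed matrices. -/
def IsN : Prop :=
  IsSimpleModule (T D x) W ∧
    ∃ b : Module.Basis (Fin ((D + 1) / 2 - k + 1)) ℂ W,
      LinearMap.toMatrix b b (Algebra.lsmul ℂ ℂ W (genA D x)) = matN D k ∧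
      LinearMap.toMatrix b b (Algebra.lsmul ℂ ℂ W (genAstar D x)) =
        matStar D k ((D + 1) / 2 - k + 1)

end Modules

/-- The even integers `k` with `0 ≤ k ≤ ⌊D/2⌋`. -/
abbrev IdxM (D : ℕ) : Type := {k : ℕ // Even k ∧ k ≤ D / 2}

/-- The even integers `k` with `2 ≤ k ≤ ⌈D/2⌉`. -/
abbrev IdxN (D : ℕ) : Type := {k : ℕ // Even k ∧ 2 ≤ k ∧ k ≤ (D + 1) / 2}

end HalvedCube

open HalvedCube

/-!
Identify the vertices with the even subsets of `Fin D`, a vertex `y` with the set of coordinates in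
which it differs from `x`. On the functions on *all* subsets, the raising operator `R` and the
lowering operator `L` generate an action of `sl₂`, with `[L, R] = D - 2 |S|` (`lower_raise_apply`).
The adjacency operator of the full cube is `R + L`, and `(R + L)² = D + 2 A` on even sets
(`cubeAdj_cubeAdj_apply`, `genA_smul_pull`). So the Terwilliger algebra of the halved cube acts
through `sl₂`, and each `sl₂`-string `u, R u, R² u / 2!, …` of a lowest weight vector `u` in level
`k` contributes its members in the even levels. These span a copy of `M_k` if `k` is even and of
`N_{k + 1}` if `k` is odd, except that there are none if `k` is odd and `2 k = D`
(`genA_smul_str_matM`, `genA_smul_str_matN`).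

Rank-nullity gives at least `C(D, k) - C(D, k - 1)` orthonormal lowest weight vectors in level `k`
(`exists_orthonormal_isLowest`). Since `R` and `L` are adjoint, strings that start from orthogonal
lowest weight vectors are orthogonal, so the even members of all these strings are linearly
independent. Counting them level by level shows that there are as many as vertices
(`sum_mult_mul_dim`); hence they form a basis of the standard module (`exists_basis_standard`).

The modules `M_k` and `N_k` are simple because `A*` has distinct eigenvalues and `A` is irreducibly
tridiagonal (`isSimpleModule_of_tridiag`). As `A` and `A*` generate the algebra, the matrices
determine the module (`exists_hom_of_basis`), so any copies of the `M_k` and `N_k` map to the spans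
of the strings, and the assembled map sends a basis to a basis.
-/

namespace HalvedCube

/-! ### The action of `sl₂` on the functions on the cube -/

section Cube

section

variable {α : Type*} [DecidableEq α]

/-- The raising operator on functions on the cube, whose vertices are taken to be the subsets
of `α`: the value at `S` is the sum of the values at the sets covered by `S`. -/
noncomputable def raise : EuclideanSpace ℂ (Finset α) →ₗ[ℂ] EuclideanSpace ℂ (Finset α) where
  toFun f := WithLp.toLp 2 fun S => ∑ i ∈ S, f (S.erase i)
  map_add' f g := by ext S; simp [Finset.sum_add_distrib]
  map_smul' c f := by ext S; simp [Finset.mul_sum]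

theorem raise_apply (f : EuclideanSpace ℂ (Finset α)) (S : Finset α) :
    raise f S = ∑ i ∈ S, f (S.erase i) := rfl

/-- The divided power `Rⁿ u / n!` of the raising operator `R`, applied to `u`. -/
noncomputable def divPow (u : EuclideanSpace ℂ (Finset α)) : ℕ → EuclideanSpace ℂ (Finset α)
  | 0 => u
  | n + 1 => ((n : ℂ) + 1)⁻¹ • raise (divPow u n)

theorem raise_divPow (u : EuclideanSpace ℂ (Finset α)) (n : ℕ) :
    raise (divPow u n) = ((n : ℂ) + 1) • divPow u (n + 1) := by
  rw [divPow, smul_smul, mul_inv_cancel₀ (Nat.cast_add_one_ne_zero n), one_smul]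

end

section

variable {α : Type*} [Fintype α]

/-- The functions on the cube that are supported on the sets with `k` elements. -/
def level (α : Type*) [Fintype α] (k : ℕ) : Submodule ℂ (EuclideanSpace ℂ (Finset α)) where
  carrier := {f | ∀ S, S.card ≠ k → f S = 0}
  add_mem' hf hg S hS := by simp [hf S hS, hg S hS]
  zero_mem' S hS := rfl
  smul_mem' c f hf S hS := by simp [hf S hS]

theorem inner_eq_zero_of_mem_level {k l : ℕ} (h : k ≠ l) {u u' : EuclideanSpace ℂ (Finset α)}
    (hu : u ∈ level α k) (hu' : u' ∈ level α l) : inner ℂ u u' = 0 := by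
  rw [PiLp.inner_apply]
  refine Finset.sum_eq_zero fun S _ => ?_
  by_cases hS : S.card = k
  · simp [hu' S (by omega)]
  · simp [hu S hS]

end

variable {α : Type*} [Fintype α] [DecidableEq α]

/-- The lowering operator on functions on the cube: the value at `S` is the sum of the values at
the sets that cover `S`. -/
noncomputable def lower : EuclideanSpace ℂ (Finset α) →ₗ[ℂ] EuclideanSpace ℂ (Finset α) where
  toFun f := WithLp.toLp 2 fun S => ∑ i ∈ Sᶜ, f (insert i S)
  map_add' f g := by ext S; simp [Finset.sum_add_distrib]
  map_smul' c f := by ext S; simp [Finset.mul_sum]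

theorem lower_apply (f : EuclideanSpace ℂ (Finset α)) (S : Finset α) :
    lower f S = ∑ i ∈ Sᶜ, f (insert i S) := rfl

theorem inner_raise_left (f g : EuclideanSpace ℂ (Finset α)) :
    inner ℂ (raise f) g = inner ℂ f (lower g) := by
  simp only [PiLp.inner_apply, raise_apply, lower_apply, RCLike.inner_apply, map_sum,
    Finset.mul_sum, Finset.sum_mul, Finset.sum_sigma']
  refine Finset.sum_bij' (fun a _ => ⟨a.1.erase a.2, a.2⟩) (fun a _ => ⟨insert a.2 a.1, a.2⟩)
    ?_ ?_ ?_ ?_ ?_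
  · rintro ⟨S, i⟩ h; simp
  · rintro ⟨S, i⟩ h; simp
  · rintro ⟨S, i⟩ h; simp at h; simp [Finset.insert_erase h]
  · rintro ⟨S, i⟩ h; simp at h; simp [Finset.erase_insert h]
  · rintro ⟨S, i⟩ h; simp at h; simp [Finset.insert_erase h]

/-- The commutation relation `[L, R] = H` of `sl₂`. -/
theorem lower_raise_apply (f : EuclideanSpace ℂ (Finset α)) (S : Finset α) :
    lower (raise f) S =
      raise (lower f) S + ((Fintype.card α : ℂ) - 2 * (S.card : ℂ)) * f S := by
  simp only [raise_apply, lower_apply]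
  have h1 : ∀ i ∈ Sᶜ, ∑ j ∈ insert i S, f ((insert i S).erase j) =
      f S + ∑ j ∈ S, f (insert i (S.erase j)) := by
    intro i hi
    have hi' : i ∉ S := by simpa using hi
    rw [Finset.sum_insert hi', Finset.erase_insert hi']
    congr 1
    refine Finset.sum_congr rfl fun j hj => ?_
    rw [Finset.erase_insert_of_ne]
    rintro rfl; exact hi' hj
  have h2 : ∀ j ∈ S, ∑ i ∈ (S.erase j)ᶜ, f (insert i (S.erase j)) =
      f S + ∑ i ∈ Sᶜ, f (insert i (S.erase j)) := by
    intro j hj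
    rw [Finset.compl_erase, Finset.sum_insert (by simpa using hj), Finset.insert_erase hj]
  rw [Finset.sum_congr rfl h1, Finset.sum_congr rfl h2, Finset.sum_add_distrib,
    Finset.sum_add_distrib, Finset.sum_comm]
  have h3 : ((Sᶜ.card : ℕ) : ℂ) = (Fintype.card α : ℂ) - S.card := by
    rw [Finset.card_compl, Nat.cast_sub (Finset.card_le_univ S)]
  simp only [Finset.sum_const, nsmul_eq_mul, h3]
  ring

theorem raise_mem_level {k : ℕ} {f : EuclideanSpace ℂ (Finset α)} (hf : f ∈ level α k) :
    raise f ∈ level α (k + 1) := by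
  intro S hS
  rw [raise_apply]
  refine Finset.sum_eq_zero fun i hi => hf _ ?_
  rw [Finset.card_erase_of_mem hi]
  have := Finset.card_pos.2 ⟨i, hi⟩
  omega

theorem lower_raise_of_mem_level {k : ℕ} {f : EuclideanSpace ℂ (Finset α)} (hf : f ∈ level α k) :
    lower (raise f) = raise (lower f) + ((Fintype.card α : ℂ) - 2 * (k : ℂ)) • f := by
  ext S
  rw [lower_raise_apply, PiLp.add_apply, PiLp.smul_apply, smul_eq_mul]
  by_cases hS : S.card = k
  · rw [hS]
  · simp [hf S hS]

/-- The lowest weight vectors in level `k`: the functions on level `k` that the lowering operator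
annihilates. -/
def IsLowest (k : ℕ) (u : EuclideanSpace ℂ (Finset α)) : Prop :=
  u ∈ level α k ∧ lower u = 0

theorem divPow_mem_level {k : ℕ} {u : EuclideanSpace ℂ (Finset α)} (hu : u ∈ level α k) (n : ℕ) :
    divPow u n ∈ level α (k + n) := by
  induction n with
  | zero => exact hu
  | succ n ih => exact Submodule.smul_mem _ _ (raise_mem_level ih)

theorem lower_divPow {k : ℕ} {u : EuclideanSpace ℂ (Finset α)} (hu : IsLowest k u) (n : ℕ) :
    lower (divPow u (n + 1)) = ((Fintype.card α : ℂ) - 2 * k - n) • divPow u n := by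
  have hn : ∀ n : ℕ, ((n : ℂ) + 1) ≠ 0 := Nat.cast_add_one_ne_zero
  induction n with
  | zero =>
    simp [divPow, lower_raise_of_mem_level hu.1, hu.2]
  | succ n ih =>
    rw [divPow, map_smul, lower_raise_of_mem_level (divPow_mem_level hu.1 _), ih, map_smul,
      raise_divPow, smul_smul, ← add_smul, smul_smul]
    congr 1
    have := hn (n + 1)
    push_cast at this ⊢
    field_simp
    ring

theorem inner_divPow_succ {l : ℕ} (u : EuclideanSpace ℂ (Finset α))
    {u' : EuclideanSpace ℂ (Finset α)} (hu' : IsLowest l u') (n m : ℕ) :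
    inner ℂ (divPow u (n + 1)) (divPow u' (m + 1)) =
      ((n : ℂ) + 1)⁻¹ * ((Fintype.card α : ℂ) - 2 * l - m) * inner ℂ (divPow u n) (divPow u' m) := by
  rw [divPow, inner_smul_left, inner_raise_left, lower_divPow hu', inner_smul_right]
  simp [mul_assoc]

/-- The strings of orthogonal lowest weight vectors are orthogonal. -/
theorem inner_divPow_eq_zero {k l : ℕ} {u u' : EuclideanSpace ℂ (Finset α)}
    (hu : IsLowest k u) (hu' : IsLowest l u') (h : inner ℂ u u' = 0) (n m : ℕ) :
    inner ℂ (divPow u n) (divPow u' m) = 0 := by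
  induction n generalizing m with
  | zero =>
    cases m with
    | zero => exact h
    | succ m =>
      rw [← inner_conj_symm]
      simp [divPow, inner_smul_left, inner_raise_left, hu.2]
  | succ n ih =>
    cases m with
    | zero => simp [divPow, inner_raise_left, hu'.2]
    | succ m => rw [inner_divPow_succ u hu', ih, mul_zero]

theorem divPow_ne_zero {k : ℕ} {u : EuclideanSpace ℂ (Finset α)} (hu : IsLowest k u) (hu0 : u ≠ 0)
    {n : ℕ} (hn : 2 * k + n ≤ Fintype.card α) : divPow u n ≠ 0 := by
  induction n with
  | zero => exact hu0
  | succ n ih =>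
    intro h
    have h1 := lower_divPow hu n
    rw [h, map_zero] at h1
    refine smul_ne_zero ?_ (ih (by omega)) h1.symm
    obtain ⟨c, hc⟩ := Nat.exists_eq_add_of_le hn
    rw [hc]; push_cast
    have := Nat.cast_add_one_ne_zero (R := ℂ) c
    convert this using 1; ring

/-- The first vanishing divided power has square norm `0`, because the lowering operator sends it
to a multiple of its predecessor with coefficient `0`. -/
theorem divPow_eq_zero {k : ℕ} {u : EuclideanSpace ℂ (Finset α)} (hu : IsLowest k u)
    (hk : 2 * k ≤ Fintype.card α) {n : ℕ} (hn : Fintype.card α < 2 * k + n) : divPow u n = 0 := by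
  obtain ⟨c, hc⟩ := Nat.exists_eq_add_of_le hk
  obtain ⟨j, rfl⟩ : ∃ j, n = c + 1 + j := Nat.exists_eq_add_of_le (by omega)
  clear hn
  induction j with
  | zero =>
    rw [add_zero, ← inner_self_eq_zero (𝕜 := ℂ), inner_divPow_succ u hu, hc]
    push_cast; ring
  | succ j ih => rw [← add_assoc, divPow, ih, map_zero, smul_zero]

/-- The adjacency operator of the cube, as the sum of the raising and the lowering operator. -/
noncomputable def cubeAdj : EuclideanSpace ℂ (Finset α) →ₗ[ℂ] EuclideanSpace ℂ (Finset α) :=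
  raise + lower

theorem cubeAdj_apply (f : EuclideanSpace ℂ (Finset α)) (S : Finset α) :
    cubeAdj f S = ∑ i, f (symmDiff S {i}) := by
  rw [cubeAdj, LinearMap.add_apply, PiLp.add_apply, raise_apply, lower_apply,
    ← Finset.sum_add_sum_compl S]
  congr 1
  · refine Finset.sum_congr rfl fun i hi => ?_
    have : S.erase i = symmDiff S {i} := by ext j; simp [Finset.mem_symmDiff]; grind
    rw [this]
  · refine Finset.sum_congr rfl fun i hi => ?_
    have hi' : i ∉ S := by simpa using hi
    have : insert i S = symmDiff S {i} := by ext j; simp [Finset.mem_symmDiff]; grind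
    rw [this]

/-- A sum over the ordered pairs of distinct elements is twice the sum over the two-element
sets. -/
theorem sum_offDiag_symmDiff (g : Finset α → ℂ) :
    ∑ a ∈ (Finset.univ : Finset α).offDiag, g (symmDiff {a.1} {a.2}) =
      2 * ∑ P ∈ Finset.powersetCard 2 Finset.univ, g P := by
  rw [← Finset.sum_fiberwise_of_maps_to (t := Finset.powersetCard 2 Finset.univ)
    (g := fun a : α × α => symmDiff ({a.1} : Finset α) {a.2}), Finset.mul_sum]
  · refine Finset.sum_congr rfl fun P hP => ?_
    obtain ⟨a, b, hab, rfl⟩ := Finset.card_eq_two.1 (Finset.mem_powersetCard.1 hP).2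
    have : {c ∈ (Finset.univ : Finset α).offDiag | symmDiff ({c.1} : Finset α) {c.2} = {a, b}} =
        {(a, b), (b, a)} := by
      ext ⟨c, d⟩
      simp only [Finset.mem_filter, Finset.mem_offDiag, Finset.mem_univ, true_and,
        Finset.mem_insert, Finset.mem_singleton, Prod.mk.injEq, Finset.ext_iff,
        Finset.mem_symmDiff]
      constructor
      · rintro ⟨hcd, h⟩
        have h1 := h a
        have h2 := h b
        grind
      · rintro (⟨rfl, rfl⟩ | ⟨rfl, rfl⟩)
        · exact ⟨hab, fun i => by grind⟩
        · exact ⟨hab.symm, fun i => by grind⟩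
    rw [this, Finset.sum_pair (by simp [hab])]
    have h2 : symmDiff ({b} : Finset α) {a} = symmDiff {a} {b} := symmDiff_comm _ _
    have h1 : symmDiff ({a} : Finset α) {b} = {a, b} := by
      ext; simp [Finset.mem_symmDiff]; grind
    simp only [h2, h1, two_mul]
  · rintro ⟨c, d⟩ h
    have hcd : c ≠ d := by simpa using h
    rw [Finset.mem_powersetCard]
    refine ⟨Finset.subset_univ _, Finset.card_eq_two.2 ⟨c, d, hcd, ?_⟩⟩
    ext; simp [Finset.mem_symmDiff]; grind

/-- The square of the adjacency operator of the cube, in terms of the distance-two operator. -/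
theorem cubeAdj_cubeAdj_apply (f : EuclideanSpace ℂ (Finset α)) (S : Finset α) :
    cubeAdj (cubeAdj f) S = (Fintype.card α : ℂ) * f S +
      2 * ∑ P ∈ Finset.powersetCard 2 Finset.univ, f (symmDiff S P) := by
  simp only [cubeAdj_apply]
  rw [← Finset.sum_product', ← Finset.diag_union_offDiag,
    Finset.sum_union (Finset.disjoint_diag_offDiag _), ← sum_offDiag_symmDiff]
  congr 1
  · rw [Finset.sum_diag]; simp
  · simp [symmDiff_assoc]

/-- The operator `(R + L)²` on a string; `v` is the member two steps below `divPow u n`, or `0`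
if there is none. -/
theorem cubeAdj_cubeAdj_divPow {k : ℕ} {u : EuclideanSpace ℂ (Finset α)} (hu : IsLowest k u)
    (n : ℕ) (v : EuclideanSpace ℂ (Finset α))
    (hv : (∃ m, n = m + 2 ∧ v = divPow u m) ∨ (n < 2 ∧ v = 0)) :
    cubeAdj (cubeAdj (divPow u n)) =
      (((n : ℂ) + 1) * (n + 2)) • divPow u (n + 2) +
      ((2 * n * ((Fintype.card α : ℂ) - 2 * k - n) + Fintype.card α - 2 * k)) • divPow u n +
      (((Fintype.card α : ℂ) - 2 * k - n + 1) * ((Fintype.card α : ℂ) - 2 * k - n + 2)) • v := by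
  have h0 : lower (divPow u 0) = 0 := hu.2
  rcases hv with ⟨m, rfl, rfl⟩ | ⟨h, rfl⟩
  · simp only [cubeAdj, LinearMap.add_apply, raise_divPow, lower_divPow hu, map_add, map_smul]
    push_cast
    module
  · interval_cases n <;>
      simp only [cubeAdj, LinearMap.add_apply, raise_divPow, lower_divPow hu, map_add, map_smul,
        h0, map_zero, smul_zero] <;>
      push_cast <;> module

/-! ### Lowest weight vectors and their number -/

/-- The multiplicity `C(n, k) - C(n, k - 1)` of the irreducible `sl₂`-module with lowest weight
vectors in level `k`. The subtraction does not truncate as long as `2 * k ≤ n`. -/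
def mult (n : ℕ) : ℕ → ℕ
  | 0 => 1
  | k + 1 => n.choose (k + 1) - n.choose k

/-- Rank-nullity for the lowering operator from level `k` to level `k - 1`. -/
theorem exists_orthonormal_isLowest (α : Type*) [Fintype α] [DecidableEq α] (k : ℕ) :
    ∃ u : Fin (mult (Fintype.card α) k) → EuclideanSpace ℂ (Finset α),
      Orthonormal ℂ u ∧ ∀ m, IsLowest k (u m) := by
  let K : Submodule ℂ (EuclideanSpace ℂ (Finset α)) := level α k ⊓ LinearMap.ker lower
  have hK : mult (Fintype.card α) k ≤ Module.finrank ℂ K := by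
    -- extension by zero from level `k`
    let ext : ({S : Finset α // S.card = k} → ℂ) →ₗ[ℂ] EuclideanSpace ℂ (Finset α) :=
      { toFun := fun f => WithLp.toLp 2 fun S => if h : S.card = k then f ⟨S, h⟩ else 0
        map_add' := fun f g => by ext S; by_cases h : S.card = k <;> simp [h]
        map_smul' := fun c f => by ext S; by_cases h : S.card = k <;> simp [h] }
    have hext : Function.Injective ext := by
      intro f g h
      funext S
      have := congrArg (fun v : EuclideanSpace ℂ (Finset α) => v S.1) h
      simpa [ext, S.2] using this
    have hlev : ∀ f, ext f ∈ level α k := fun f S hS => by simp [ext, hS]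
    let low : ({S : Finset α // S.card = k} → ℂ) →ₗ[ℂ] ({S : Finset α // S.card + 1 = k} → ℂ) :=
      { toFun := fun f S => lower (ext f) S.1
        map_add' := fun f g => by ext S; simp
        map_smul' := fun c f => by ext S; simp }
    have hker : (LinearMap.ker low).map ext ≤ K := by
      rintro _ ⟨f, hf, rfl⟩
      refine ⟨hlev f, ?_⟩
      ext S
      by_cases hS : S.card + 1 = k
      · exact congrFun hf ⟨S, hS⟩
      · rw [lower_apply]
        refine Finset.sum_eq_zero fun i hi => hlev f _ ?_
        rwa [Finset.card_insert_of_notMem (by simpa using hi)]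
    have h1 := low.finrank_range_add_finrank_ker
    have h2 := Submodule.finrank_mono hker
    rw [LinearEquiv.finrank_eq (Submodule.equivMapOfInjective ext hext _).symm] at h2
    have h3 := Submodule.finrank_le (LinearMap.range low)
    rw [Module.finrank_fintype_fun_eq_card] at h1 h3
    have h4 : Fintype.card {S : Finset α // S.card = k} = (Fintype.card α).choose k :=
      Fintype.card_finset_len k
    cases k with
    | zero =>
      have : IsEmpty {S : Finset α // S.card + 1 = 0} := ⟨fun S => by simpa using S.2⟩
      simp only [Fintype.card_eq_zero, Nat.choose_zero_right] at h3 h4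
      simp only [mult]; omega
    | succ k =>
      have h5 : Fintype.card {S : Finset α // S.card + 1 = k + 1} = (Fintype.card α).choose k := by
        rw [← Fintype.card_finset_len k]
        exact Fintype.card_congr (Equiv.subtypeEquivRight fun S => by simp)
      simp only [mult]; omega
  let b := stdOrthonormalBasis ℂ K
  refine ⟨fun m => (b (Fin.castLE hK m) : EuclideanSpace ℂ (Finset α)), ?_, fun m =>
    ⟨(b (Fin.castLE hK m)).2.1, (b (Fin.castLE hK m)).2.2⟩⟩
  exact (b.orthonormal.comp_linearIsometry K.subtypeₗᵢ).comp _ (Fin.castLE_injective hK)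

end Cube

/-! ### Counting the even members of the strings -/

theorem mult_pos {n k : ℕ} (h : 2 * k ≤ n) : 0 < mult n k := by
  cases k with
  | zero => exact Nat.one_pos
  | succ k =>
    refine Nat.sub_pos_of_lt (lt_of_mul_lt_mul_right ?_ (Nat.zero_le (k + 1)))
    rw [Nat.choose_succ_right_eq]
    exact Nat.mul_lt_mul_of_pos_left (by omega) (Nat.choose_pos (by omega))

theorem mult_cast {n k : ℕ} (h : 2 * k ≤ n) :
    (mult n k : ℚ) = ((n : ℚ) - 2 * k + 1) / ((n : ℚ) - k + 1) * (n.choose k : ℚ) := by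
  obtain ⟨c, rfl⟩ := Nat.exists_eq_add_of_le h
  cases k with
  | zero =>
    have : (c : ℚ) + 1 ≠ 0 := by positivity
    simp [mult, div_self this]
  | succ k =>
    have h1 := mult_pos h
    simp only [mult] at h1 ⊢
    have h2 := Nat.choose_succ_right_eq (2 * (k + 1) + c) k
    rw [show 2 * (k + 1) + c - k = k + c + 2 by omega] at h2
    have h3 : (((2 * (k + 1) + c).choose (k + 1) : ℕ) : ℚ) * (k + 1) =
      ((2 * (k + 1) + c).choose k : ℕ) * (k + c + 2) := by exact_mod_cast h2
    rw [Nat.cast_sub (by omega)]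
    have h4 : (k : ℚ) + c + 2 ≠ 0 := by positivity
    push_cast
    rw [show (2 * ((k : ℚ) + 1) + c - 2 * (k + 1) + 1) = c + 1 by ring,
      show (2 * ((k : ℚ) + 1) + c - (k + 1) + 1) = k + c + 2 by ring,
      div_mul_eq_mul_div, eq_div_iff h4]
    linear_combination h3

theorem sum_mult {n j : ℕ} (h : 2 * j ≤ n + 1) :
    ∑ k ∈ Finset.range (j + 1), mult n k = n.choose j := by
  induction j with
  | zero => simp [mult]
  | succ j ih =>
    rw [Finset.sum_range_succ, ih (by omega), mult]
    refine Nat.add_sub_cancel' (le_of_mul_le_mul_right ?_ (Nat.succ_pos j))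
    rw [Nat.choose_succ_right_eq]
    exact Nat.mul_le_mul_left _ (by omega)

/-- The strings that meet the level `j` are those that start at a level `k ≤ min j (n - j)`. -/
theorem sum_mult_filter {n j : ℕ} (h : j ≤ n) :
    ∑ k ∈ Finset.range (n / 2 + 1) with k ≤ j ∧ j + k ≤ n, mult n k = n.choose j := by
  have : Finset.filter (fun k => k ≤ j ∧ j + k ≤ n) (Finset.range (n / 2 + 1)) =
      Finset.range (min j (n - j) + 1) := by
    ext k; simp only [Finset.mem_filter, Finset.mem_range]; omega
  rw [this, sum_mult (by omega)]
  rcases le_total j (n - j) with h' | h'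
  · rw [min_eq_left h']
  · rw [min_eq_right h', Nat.choose_symm h]

/-- The number of even levels that a string from level `k` to level `n - k` meets. -/
theorem card_even_levels {n k : ℕ} (h : 2 * k ≤ n) :
    ((Finset.range (n + 1)).filter fun j => Even j ∧ k ≤ j ∧ j + k ≤ n).card =
      if Even k then n / 2 - k + 1 else (n + 1) / 2 - k := by
  split_ifs with hk
  · rw [← Finset.card_range (n / 2 - k + 1)]
    symm
    refine Finset.card_nbij' (fun i => k + 2 * i) (fun j => (j - k) / 2) ?_ ?_ ?_ ?_
    · intro i hi; simp at hi ⊢; grind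
    · intro j hj; simp at hj ⊢; grind
    · intro i hi; simp
    · intro j hj; simp at hj ⊢; grind
  · rw [← Finset.card_range ((n + 1) / 2 - k)]
    symm
    refine Finset.card_nbij' (fun i => k + 1 + 2 * i) (fun j => (j - k) / 2) ?_ ?_ ?_ ?_
    · intro i hi; simp at hi ⊢; grind
    · intro j hj; simp at hj ⊢; grind
    · intro i hi; simp; omega
    · intro j hj; simp at hj ⊢; grind

theorem sum_mult_mul (n : ℕ) :
    ∑ k ∈ Finset.range (n / 2 + 1), mult n k * (if Even k then n / 2 - k + 1 else (n + 1) / 2 - k) =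
      ∑ j ∈ Finset.range (n + 1) with Even j, n.choose j := by
  have h1 : ∀ k ∈ Finset.range (n / 2 + 1),
      mult n k * (if Even k then n / 2 - k + 1 else (n + 1) / 2 - k) =
      ∑ j ∈ Finset.range (n + 1) with Even j, if k ≤ j ∧ j + k ≤ n then mult n k else 0 := by
    intro k hk
    rw [← card_even_levels (by simp at hk; omega), ← Finset.sum_filter, Finset.filter_filter,
      Finset.sum_const, smul_eq_mul, mul_comm]
  rw [Finset.sum_congr rfl h1, Finset.sum_comm]
  refine Finset.sum_congr rfl fun j hj => ?_
  rw [← Finset.sum_filter, sum_mult_filter]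
  simp at hj; omega

theorem card_even_finset (n : ℕ) :
    Fintype.card {S : Finset (Fin n) // Even S.card} =
      ∑ j ∈ Finset.range (n + 1) with Even j, n.choose j := by
  have := Finset.sum_powerset_apply_card (x := (Finset.univ : Finset (Fin n)))
    (fun j => if Even j then 1 else 0)
  rw [Fintype.card_subtype, Finset.card_filter, Finset.sum_filter]
  simpa using this

instance (n : ℕ) : Fintype (IdxM n) :=
  Fintype.subtype ((Finset.range (n / 2 + 1)).filter Even) fun k => by
    simp only [Finset.mem_filter, Finset.mem_range]; grind

instance (n : ℕ) : Fintype (IdxN n) :=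
  Fintype.subtype ((Finset.range ((n + 1) / 2 + 1)).filter fun k => Even k ∧ 2 ≤ k) fun k => by
    simp only [Finset.mem_filter, Finset.mem_range]; grind

theorem sum_idxM (n : ℕ) (f : ℕ → ℕ) :
    ∑ k : IdxM n, f k = ∑ k ∈ Finset.range (n / 2 + 1) with Even k, f k :=
  (Finset.sum_subtype _ (fun k => by simp only [Finset.mem_filter, Finset.mem_range]; grind) f).symm

theorem sum_idxN (n : ℕ) (f : ℕ → ℕ) (hf : ∀ k, (n + 1) / 2 ≤ k → f k = 0) :
    ∑ k : IdxN n, f ((k : ℕ) - 1) = ∑ k ∈ Finset.range (n / 2 + 1) with ¬ Even k, f k := by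
  rw [← Finset.sum_subtype ((Finset.range ((n + 1) / 2 + 1)).filter fun k => Even k ∧ 2 ≤ k)
    (fun k => by simp only [Finset.mem_filter, Finset.mem_range]; grind) (fun k => f (k - 1))]
  have : ∑ k ∈ Finset.range (n / 2 + 1) with ¬ Even k, f k =
      ∑ k ∈ Finset.range ((n + 1) / 2) with ¬ Even k, f k := by
    symm
    refine Finset.sum_subset ?_ fun k hk hk' => hf k ?_
    · intro k hk; simp only [Finset.mem_filter, Finset.mem_range] at hk ⊢; grind
    · simp only [Finset.mem_filter, Finset.mem_range] at hk hk'; grind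
  rw [this]
  refine Finset.sum_nbij' (fun k => k - 1) (fun k => k + 1) ?_ ?_ ?_ ?_ ?_ <;>
    intro k hk <;> simp only [Finset.mem_filter, Finset.mem_range] at hk ⊢ <;> grind

/-- The dimensions of the claimed constituents add up to the number of even subsets. -/
theorem sum_mult_mul_dim (n : ℕ) :
    ∑ k : IdxM n, mult n k * (n / 2 - k + 1) +
      ∑ k : IdxN n, mult n ((k : ℕ) - 1) * ((n + 1) / 2 - k + 1) =
        Fintype.card {S : Finset (Fin n) // Even S.card} := by
  -- in the range of `k`, the truncated subtractions agree
  have hN : ∀ k : IdxN n, mult n ((k : ℕ) - 1) * ((n + 1) / 2 - k + 1) =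
      mult n ((k : ℕ) - 1) * ((n + 1) / 2 - ((k : ℕ) - 1)) := by
    rintro ⟨k, h⟩
    congr 1; simp only; omega
  rw [card_even_finset, ← sum_mult_mul, Finset.sum_congr rfl fun k _ => hN k,
    sum_idxM n fun k => mult n k * (n / 2 - k + 1),
    sum_idxN n (fun k => mult n k * ((n + 1) / 2 - k)) (fun k hk => by
      simp [Nat.sub_eq_zero_of_le hk]),
    ← Finset.sum_filter_add_sum_filter_not (Finset.range (n / 2 + 1)) Even]
  congr 1 <;> refine Finset.sum_congr rfl fun k hk => ?_
  · rw [if_pos (Finset.mem_filter.1 hk).2]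
  · rw [if_neg (Finset.mem_filter.1 hk).2]

/-! ### Modules over the Terwilliger algebra -/

/-- The action of a tridiagonal matrix on the initial segment of a sequence, in three-term form. The
top term `f n` is out of range, so it has to vanish. -/
theorem sum_tridiag {n : ℕ} (α β γ : ℕ → ℂ) {W : Type*} [AddCommGroup W] [Module ℂ W]
    (f : ℕ → W) (hf : f n = 0) (i : Fin n) :
    ∑ j : Fin n, tridiag n α β γ j i • f j =
      β i • f (i + 1) + α i • f i + (if (i : ℕ) = 0 then 0 else γ i • f (i - 1)) := by
  have h : ∀ j : Fin n, tridiag n α β γ j i • f j =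
      (if (j : ℕ) = i + 1 then β i • f (i + 1) else 0) + (if (j : ℕ) = i then α i • f i else 0) +
      (if (i : ℕ) = j + 1 then γ i • f (i - 1) else 0) := by
    intro j
    simp only [tridiag, Matrix.of_apply]
    split_ifs <;> first | omega | simp_all
  rw [Finset.sum_congr rfl fun j _ => h j, Finset.sum_add_distrib, Finset.sum_add_distrib]
  congr 1
  · congr 1
    · by_cases hi : (i : ℕ) + 1 < n
      · rw [Finset.sum_eq_single ⟨i + 1, hi⟩] <;> simp +contextual [Fin.ext_iff]
      · have : (i : ℕ) + 1 = n := by omega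
        rw [this, hf]; simp
    · rw [Finset.sum_eq_single i] <;> simp +contextual [Fin.ext_iff]
  · split_ifs with hi
    · refine Finset.sum_eq_zero fun j _ => if_neg (by omega)
    · rw [Finset.sum_eq_single ⟨i - 1, by omega⟩]
      · rw [if_pos (by simp; omega)]
      · intro j _ hj; rw [if_neg]; simp [Fin.ext_iff] at hj; omega
      · simp

section Simple

variable {D : ℕ} {x : X D} {W : Type*} [AddCommGroup W] [Module ℂ W]
  [Module (T D x) W] [IsScalarTower ℂ (T D x) W]

/-- A linear map that commutes with the two generators of `T` commutes with `T`. -/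
theorem map_smul_of_generators {W' : Type*} [AddCommGroup W'] [Module ℂ W']
    [Module (T D x) W'] [IsScalarTower ℂ (T D x) W'] (f : W →ₗ[ℂ] W')
    (hA : ∀ v, f (genA D x • v) = genA D x • f v)
    (hAstar : ∀ v, f (genAstar D x • v) = genAstar D x • f v) (t : T D x) (v : W) :
    f (t • v) = t • f v := by
  obtain ⟨t, ht⟩ := t
  induction ht using Algebra.adjoin_induction generalizing v with
  | mem t ht =>
    rcases ht with rfl | rfl
    · exact hA v
    · exact hAstar v
  | algebraMap r =>
    have h : (⟨_, Subalgebra.algebraMap_mem (T D x) r⟩ : T D x) = algebraMap ℂ (T D x) r := rfl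
    rw [h, algebraMap_smul, algebraMap_smul, map_smul]
  | add s t hs ht h1 h2 =>
    have h : (⟨s + t, add_mem hs ht⟩ : T D x) = ⟨s, hs⟩ + ⟨t, ht⟩ := rfl
    rw [h, add_smul, add_smul, map_add, h1, h2]
  | mul s t hs ht h1 h2 =>
    have h : (⟨s * t, mul_mem hs ht⟩ : T D x) = ⟨s, hs⟩ * ⟨t, ht⟩ := rfl
    rw [h, mul_smul, mul_smul, h1, h2]

/-- A subspace that is stable under the two generators of `T`, as a `T`-submodule. -/
def submoduleOfGenerators (V : Submodule ℂ W) (hA : ∀ v ∈ V, genA D x • v ∈ V)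
    (hAstar : ∀ v ∈ V, genAstar D x • v ∈ V) : Submodule (T D x) W where
  toAddSubmonoid := V.toAddSubmonoid
  smul_mem' := by
    rintro ⟨t, ht⟩ v hv
    change _ ∈ V
    replace hv : v ∈ V := hv
    induction ht using Algebra.adjoin_induction generalizing v with
    | mem t ht =>
      rcases ht with rfl | rfl
      · exact hA v hv
      · exact hAstar v hv
    | algebraMap r =>
      have h : (⟨_, Subalgebra.algebraMap_mem (T D x) r⟩ : T D x) = algebraMap ℂ (T D x) r := rfl
      rw [h, algebraMap_smul]
      exact V.smul_mem r hv
    | add s t hs ht h1 h2 =>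
      have h : (⟨s + t, add_mem hs ht⟩ : T D x) = ⟨s, hs⟩ + ⟨t, ht⟩ := rfl
      rw [h, add_smul]
      exact V.add_mem (h1 hv) (h2 hv)
    | mul s t hs ht h1 h2 =>
      have h : (⟨s * t, mul_mem hs ht⟩ : T D x) = ⟨s, hs⟩ * ⟨t, ht⟩ := rfl
      rw [h, mul_smul]
      exact h1 (h2 hv)

theorem smul_basis_of_toMatrix {t : T D x} {n : ℕ} (b : Module.Basis (Fin n) ℂ W)
    {m : Matrix (Fin n) (Fin n) ℂ} (ht : LinearMap.toMatrix b b (Algebra.lsmul ℂ ℂ W t) = m)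
    (i : Fin n) : t • b i = ∑ j, m j i • b j := by
  rw [← b.sum_repr (t • b i), ← ht]
  simp [LinearMap.toMatrix_apply]

theorem genAstar_smul_basis {n k : ℕ} (b : Module.Basis (Fin n) ℂ W)
    (hA : LinearMap.toMatrix b b (Algebra.lsmul ℂ ℂ W (genAstar D x)) = matStar D k n) (i : Fin n) :
    genAstar D x • b i = ((D : ℂ) - 2 * (2 * (i : ℕ) + k)) • b i := by
  rw [smul_basis_of_toMatrix b hA, Finset.sum_eq_single i]
  · simp [matStar]
  · intro j _ hj; simp [matStar, hj]
  · simp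

/-- A module on which `A` acts irreducibly tridiagonally and `A*` acts with distinct eigenvalues is
simple: polynomials in `A*` cut out the basis vectors, and `A` connects neighbouring ones. -/
theorem isSimpleModule_of_tridiag {n k : ℕ} (b : Module.Basis (Fin (n + 1)) ℂ W)
    {α β γ : ℕ → ℂ} (hβ : ∀ i, i < n → β i ≠ 0) (hγ : ∀ i, i < n → γ (i + 1) ≠ 0)
    (hA : ∀ i, genA D x • b i = ∑ j, tridiag (n + 1) α β γ j i • b j)
    (hAstar : ∀ i : Fin (n + 1), genAstar D x • b i = ((D : ℂ) - 2 * (2 * (i : ℕ) + k)) • b i) :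
    IsSimpleModule (T D x) W := by
  have hnt : Nontrivial W := ⟨b 0, 0, b.ne_zero 0⟩
  have hc : ∀ (N : Submodule (T D x) W) (c : ℂ) (v : W), v ∈ N → c • v ∈ N := fun N c v hv => by
    rw [← algebraMap_smul (T D x) c v]; exact N.smul_mem _ hv
  have hmem : ∀ (N : Submodule (T D x) W) (v : W), v ∈ N → ∀ i, b.repr v i ≠ 0 → b i ∈ N := by
    intro N v hv i hi
    -- apply `∏ j ∈ s, (A* - θ j)` to `v`, with the eigenvalues `θ j` of `A*`
    have key : ∀ s : Finset (Fin (n + 1)),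
        ∑ l, (b.repr v l * ∏ j ∈ s, ((l : ℂ) - (j : ℂ))) • b l ∈ N := by
      intro s
      induction s using Finset.induction_on with
      | empty => simpa [b.sum_repr] using hv
      | insert j s hj ih =>
        -- the eigenvalues `D - 2 (2 l + k)` and `D - 2 (2 j + k)` differ by `-4 (l - j)`
        have h1 := hc N (-1 / 4) _ (N.sub_mem (N.smul_mem (genAstar D x) ih)
          (hc N ((D : ℂ) - 2 * (2 * (j : ℕ) + k)) _ ih))
        convert h1 using 1
        rw [Finset.smul_sum, Finset.smul_sum, ← Finset.sum_sub_distrib, Finset.smul_sum]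
        refine Finset.sum_congr rfl fun l _ => ?_
        rw [smul_comm (genAstar D x), hAstar, smul_smul, smul_smul, ← sub_smul, smul_smul,
          Finset.prod_insert hj]
        congr 1
        ring
    have h1 := key (Finset.univ.erase i)
    rw [Finset.sum_eq_single i] at h1
    · have hne : b.repr v i * ∏ j ∈ Finset.univ.erase i, ((i : ℂ) - (j : ℂ)) ≠ 0 := by
        refine mul_ne_zero hi (Finset.prod_ne_zero_iff.2 fun j hj => sub_ne_zero.2 ?_)
        intro h
        exact Finset.ne_of_mem_erase hj (Fin.ext (by exact_mod_cast h.symm))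
      have h2 := hc N (b.repr v i * ∏ j ∈ Finset.univ.erase i, ((i : ℂ) - (j : ℂ)))⁻¹ _ h1
      rwa [smul_smul, inv_mul_cancel₀ hne, one_smul] at h2
    · intro l _ hl
      rw [Finset.prod_eq_zero (i := l) (by simp [hl]) (sub_self _), mul_zero, zero_smul]
    · simp
  have hrepr : ∀ i j, b.repr (genA D x • b i) j = tridiag (n + 1) α β γ j i := fun i j => by
    rw [hA, b.repr_sum_self]
  have hstep : ∀ (N : Submodule (T D x) W) (i : ℕ) (hi : i < n),
      (b ⟨i, by omega⟩ ∈ N ↔ b ⟨i + 1, by omega⟩ ∈ N) := by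
    intro N i hi
    constructor <;> intro h <;> refine hmem N _ (N.smul_mem (genA D x) h) _ ?_ <;> rw [hrepr]
    · simpa [tridiag] using hβ i hi
    · have : i ≠ i + 1 + 1 := by omega
      simpa [tridiag, this] using hγ i hi
  refine { eq_bot_or_eq_top := fun N => ?_ }
  rw [or_iff_not_imp_left]
  intro hN
  obtain ⟨v, hv, hv0⟩ := N.exists_mem_ne_zero_of_ne_bot hN
  obtain ⟨i, hi⟩ : ∃ i, b.repr v i ≠ 0 := by
    by_contra! h
    exact hv0 (b.repr.map_eq_zero_iff.1 (Finsupp.ext h))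
  have h0 : ∀ i (hi : i < n + 1), b ⟨i, hi⟩ ∈ N ↔ b 0 ∈ N := by
    intro i
    induction i with
    | zero => exact fun _ => Iff.rfl
    | succ i ih => exact fun hi => (hstep N i (by omega)).symm.trans (ih (by omega))
  have hall : ∀ j, b j ∈ N := fun j => (h0 j j.2).2 ((h0 i i.2).1 (hmem N v hv i hi))
  rw [eq_top_iff]
  intro w _
  rw [← b.sum_repr w]
  exact N.sum_mem fun j _ => hc N _ _ (hall j)

/-- A linearly independent family on which the generators act by given matrices spans a
`T`-submodule on which they are represented by these matrices. -/
theorem exists_submodule_basis {n : ℕ} (f : Fin n → W) (hf : LinearIndependent ℂ f)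
    (m ms : Matrix (Fin n) (Fin n) ℂ) (hA : ∀ i, genA D x • f i = ∑ j, m j i • f j)
    (hAstar : ∀ i, genAstar D x • f i = ∑ j, ms j i • f j) :
    ∃ (N : Submodule (T D x) W) (b : Module.Basis (Fin n) ℂ N),
      LinearMap.toMatrix b b (Algebra.lsmul ℂ ℂ N (genA D x)) = m ∧
      LinearMap.toMatrix b b (Algebra.lsmul ℂ ℂ N (genAstar D x)) = ms := by
  have hs : ∀ (t : T D x) (m : Matrix (Fin n) (Fin n) ℂ), (∀ i, t • f i = ∑ j, m j i • f j) →
      ∀ v ∈ Submodule.span ℂ (Set.range f), t • v ∈ Submodule.span ℂ (Set.range f) := by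
    intro t m h v hv
    induction hv using Submodule.span_induction with
    | mem v hv =>
      obtain ⟨i, rfl⟩ := hv
      rw [h]
      exact Submodule.sum_mem _ fun j _ => Submodule.smul_mem _ _ (Submodule.subset_span ⟨j, rfl⟩)
    | zero => rw [smul_zero]; exact Submodule.zero_mem _
    | add v w _ _ hv hw => rw [smul_add]; exact Submodule.add_mem _ hv hw
    | smul c v _ hv => rw [smul_comm]; exact Submodule.smul_mem _ _ hv
  let N : Submodule (T D x) W := submoduleOfGenerators (Submodule.span ℂ (Set.range f))
    (hs _ m hA) (hs _ ms hAstar)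
  let e : Submodule.span ℂ (Set.range f) ≃ₗ[ℂ] N :=
    { toFun := fun v => ⟨v.1, v.2⟩, invFun := fun v => ⟨v.1, v.2⟩
      map_add' := fun _ _ => rfl, map_smul' := fun _ _ => rfl
      left_inv := fun _ => rfl, right_inv := fun _ => rfl }
  let b := (Module.Basis.span hf).map e
  have hb : ∀ i, (b i : W) = f i := fun i =>
    congrArg Subtype.val (Module.Basis.span_apply hf i)
  have hmat : ∀ (t : T D x) (m : Matrix (Fin n) (Fin n) ℂ), (∀ i, t • f i = ∑ j, m j i • f j) →
      LinearMap.toMatrix b b (Algebra.lsmul ℂ ℂ N t) = m := by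
    intro t m h
    ext j i
    have : t • b i = ∑ j, m j i • b j := by
      refine Subtype.ext ?_
      have hco : ((∑ j, m j i • b j : N) : W) = ∑ j, m j i • (b j : W) := by
        rw [AddSubmonoidClass.coe_finsetSum]; rfl
      rw [hco]
      simp only [hb, ← h]
      change t • (b i : W) = _
      rw [hb]
    rw [LinearMap.toMatrix_apply]
    change b.repr (t • b i) j = _
    rw [this, b.repr_sum_self]
  exact ⟨N, b, hmat _ m hA, hmat _ ms hAstar⟩

end Simple

/-! ### Restriction to the halved cube -/

section Pull

variable {D : ℕ}

/-- The set of coordinates at which two vertices differ. -/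
def diffSupp (y z : X D) : Finset (Fin D) := {i | (y.1 - z.1) i ≠ 0}

theorem card_diffSupp (y z : X D) : (diffSupp y z).card = hammingNorm (y.1 - z.1) := rfl

theorem even_hammingNorm_iff (y : Fin D → ZMod 2) : Even (hammingNorm y) ↔ ∑ i, y i = 0 := by
  have h : ∀ a : ZMod 2, a = if a ≠ 0 then 1 else 0 := by decide
  rw [Finset.sum_congr rfl fun i _ => h (y i), Finset.sum_boole, ZMod.natCast_eq_zero_iff_even]
  rfl

theorem diffSupp_symmDiff (x y z : X D) :
    symmDiff (diffSupp x y) (diffSupp y z) = diffSupp x z := by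
  ext i
  simp only [diffSupp, Finset.mem_symmDiff, Finset.mem_filter, Finset.mem_univ, true_and,
    Pi.sub_apply]
  generalize x.1 i = a
  generalize y.1 i = b
  generalize z.1 i = c
  revert a b c
  decide

/-- The bijection from the vertices to the sets of even size that sends `z` to the set of coordinates
in which it differs from the base point `y`. -/
noncomputable def diffEquiv (y : X D) : X D ≃ {S : Finset (Fin D) // Even S.card} :=
  Equiv.ofBijective
    (fun z => ⟨diffSupp y z, by
      rw [card_diffSupp, even_hammingNorm_iff]
      simp [(even_hammingNorm_iff _).1 y.2, (even_hammingNorm_iff _).1 z.2]⟩) <| by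
    constructor
    · intro z z' h
      ext i : 2
      have h1 := Finset.ext_iff.1 (Subtype.ext_iff.1 h) i
      simp only [diffSupp, Finset.mem_filter, Finset.mem_univ, true_and, Pi.sub_apply] at h1
      revert h1
      generalize y.1 i = a
      generalize z.1 i = b
      generalize z'.1 i = c
      revert a b c
      decide
    · rintro ⟨S, hS⟩
      have h1 : ∀ i, (y.1 - fun j => if j ∈ S then (1 : ZMod 2) else 0) i =
        y.1 i - if i ∈ S then 1 else 0 := fun i => rfl
      refine ⟨⟨y.1 - fun i => if i ∈ S then 1 else 0, ?_⟩, ?_⟩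
      · rw [even_hammingNorm_iff, Finset.sum_congr rfl fun i _ => h1 i, Finset.sum_sub_distrib,
          (even_hammingNorm_iff _).1 y.2, Finset.sum_boole, zero_sub, neg_eq_zero,
          ZMod.natCast_eq_zero_iff_even]
        simpa using hS
      · refine Subtype.ext ?_
        ext i
        simp [diffSupp]

/-- The restriction of a function on the cube to the vertices of the halved cube, with `x` as the
origin. -/
noncomputable def pull (x : X D) : EuclideanSpace ℂ (Finset (Fin D)) →ₗ[ℂ] (X D → ℂ) where
  toFun f y := f (diffSupp x y)
  map_add' _ _ := rfl
  map_smul' _ _ := rfl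

theorem pull_apply (x : X D) (f : EuclideanSpace ℂ (Finset (Fin D))) (y : X D) :
    pull x f y = f (diffSupp x y) := rfl

/-- The adjacency operator `A` of the halved cube is half of `(R + L)² - D`, where `R + L` is the
adjacency operator of the cube. -/
theorem genA_smul_pull (x : X D) (f : EuclideanSpace ℂ (Finset (Fin D))) :
    genA D x • pull x f = pull x ((1 / 2 : ℂ) • (cubeAdj (cubeAdj f) - (D : ℂ) • f)) := by
  funext y
  rw [smul_standard]
  change (A D).mulVec _ y = _
  rw [A, SimpleGraph.adjMatrix_mulVec_apply, pull_apply, PiLp.smul_apply, PiLp.sub_apply,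
    cubeAdj_cubeAdj_apply, PiLp.smul_apply, Fintype.card_fin, smul_eq_mul, smul_eq_mul,
    add_sub_cancel_left, ← mul_assoc]
  norm_num
  refine Finset.sum_bij (fun z _ => diffSupp y z) ?_ ?_ ?_ ?_
  · intro z hz
    rw [SimpleGraph.mem_neighborFinset] at hz
    exact Finset.mem_powersetCard.2 ⟨Finset.subset_univ _, hz⟩
  · intro z _ z' _ h
    exact (diffEquiv y).injective (Subtype.ext h)
  · intro P hP
    have hP2 := (Finset.mem_powersetCard.1 hP).2
    obtain ⟨z, hz⟩ := (diffEquiv y).surjective ⟨P, by rw [hP2]; exact even_two⟩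
    have hz' : diffSupp y z = P := congrArg Subtype.val hz
    refine ⟨z, ?_, hz'⟩
    rw [SimpleGraph.mem_neighborFinset]
    change (diffSupp y z).card = 2
    rw [hz', hP2]
  · intro z _
    rw [pull_apply, diffSupp_symmDiff]

theorem genAstar_smul_pull (x : X D) {k : ℕ} {f : EuclideanSpace ℂ (Finset (Fin D))}
    (hf : f ∈ level (Fin D) k) :
    genAstar D x • pull x f = ((D : ℂ) - 2 * (k : ℂ)) • pull x f := by
  funext y
  rw [smul_standard]
  change (Astar D x).mulVec _ y = _
  rw [Astar, Matrix.mulVec_diagonal, Pi.smul_apply, smul_eq_mul, ← card_diffSupp, pull_apply]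
  by_cases h : (diffSupp x y).card = k
  · rw [h]
  · rw [hf _ h, mul_zero, mul_zero]

/-- Restriction to the halved cube is injective on the functions supported on the even levels. -/
theorem pull_eq_zero (x : X D) {f : EuclideanSpace ℂ (Finset (Fin D))}
    (hf : ∀ S, ¬ Even S.card → f S = 0) (h : pull x f = 0) : f = 0 := by
  ext S
  by_cases hS : Even S.card
  · obtain ⟨y, hy⟩ := (diffEquiv x).surjective ⟨S, hS⟩
    have hy' : diffSupp x y = S := congrArg Subtype.val hy
    have := congrFun h y
    rwa [pull_apply, hy'] at this
  · exact hf S hS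

/-- The string of `u`, restricted to the halved cube: its members in the even levels are
`str x u ε i` for `i = 0, 1, …`, where `ε` is the parity of the level of `u`. -/
noncomputable def str (x : X D) (u : EuclideanSpace ℂ (Finset (Fin D))) (ε i : ℕ) : X D → ℂ :=
  pull x (divPow u (2 * i + ε))

theorem genAstar_smul_str (x : X D) {k : ℕ} {u : EuclideanSpace ℂ (Finset (Fin D))}
    (hu : IsLowest k u) (ε i : ℕ) :
    genAstar D x • str x u ε i = ((D : ℂ) - 2 * (2 * i + (k + ε : ℕ))) • str x u ε i := by
  rw [str, genAstar_smul_pull x (divPow_mem_level hu.1 _)]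
  congr 1; push_cast; ring

/-- `A` acts on the restricted string as `((R + L)² - D) / 2`. -/
theorem genA_smul_str (x : X D) {k : ℕ} {u : EuclideanSpace ℂ (Finset (Fin D))}
    (hu : IsLowest k u) {ε : ℕ} (hε : ε < 2) (i : ℕ) :
    genA D x • str x u ε i =
      (1 / 2 * (2 * (i : ℂ) + ε + 1) * (2 * i + ε + 2)) • str x u ε (i + 1) +
      ((2 * (i : ℂ) + ε) * ((D : ℂ) - 2 * k - (2 * i + ε)) - k) • str x u ε i +
      (if i = 0 then 0 else
        (1 / 2 * ((D : ℂ) - 2 * k - (2 * i + ε) + 1) * ((D : ℂ) - 2 * k - (2 * i + ε) + 2)) •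
          str x u ε (i - 1)) := by
  have h := cubeAdj_cubeAdj_divPow hu (2 * i + ε)
    (if i = 0 then 0 else divPow u (2 * (i - 1) + ε)) (by
      rcases i with _ | i
      · exact Or.inr ⟨by omega, if_pos rfl⟩
      · exact Or.inl ⟨2 * i + ε, by ring, by simp⟩)
  have h2 : (if i = 0 then (0 : X D → ℂ) else
      (1 / 2 * ((D : ℂ) - 2 * k - (2 * i + ε) + 1) * ((D : ℂ) - 2 * k - (2 * i + ε) + 2)) •
          str x u ε (i - 1)) =
      (1 / 2 * ((D : ℂ) - 2 * k - (2 * i + ε) + 1) * ((D : ℂ) - 2 * k - (2 * i + ε) + 2)) •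
        pull x (if i = 0 then 0 else divPow u (2 * (i - 1) + ε)) := by
    split_ifs
    · rw [map_zero, smul_zero]
    · rfl
  rw [h2]
  simp only [str]
  rw [genA_smul_pull, h, Fintype.card_fin, show 2 * (i + 1) + ε = 2 * i + ε + 2 by ring]
  simp only [← map_smul, ← map_add]
  congr 1
  push_cast
  module

theorem str_eq_zero (x : X D) {k : ℕ} {u : EuclideanSpace ℂ (Finset (Fin D))}
    (hu : IsLowest k u) (hk : 2 * k ≤ D) {ε n : ℕ} (hn : D < 2 * k + (2 * n + ε)) :
    str x u ε n = 0 := by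
  rw [str, divPow_eq_zero hu (by simpa using hk) (by simpa using hn), map_zero]

theorem genA_smul_str_matM (x : X D) {k : ℕ} {u : EuclideanSpace ℂ (Finset (Fin D))}
    (hu : IsLowest k u) (hk : k ≤ D / 2) (i : Fin (D / 2 - k + 1)) :
    genA D x • str x u 0 i = ∑ j, matM D k j i • str x u 0 j := by
  rw [matM, sum_tridiag _ _ _ (str x u 0) (str_eq_zero x hu (by omega) (by omega)),
    genA_smul_str x hu two_pos]
  congr 1
  · congr 1 <;> congr 1 <;> push_cast <;> ring
  · split_ifs
    · rfl
    · congr 1; push_cast; ring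

theorem genA_smul_str_matN (x : X D) {k : ℕ} {u : EuclideanSpace ℂ (Finset (Fin D))}
    (hu : IsLowest (k - 1) u) (hk : 2 ≤ k) (hk' : k ≤ (D + 1) / 2)
    (i : Fin ((D + 1) / 2 - k + 1)) :
    genA D x • str x u 1 i = ∑ j, matN D k j i • str x u 1 j := by
  rw [matN, sum_tridiag _ _ _ (str x u 1) (str_eq_zero x hu (by omega) (by omega)),
    genA_smul_str x hu one_lt_two]
  have h : ((k - 1 : ℕ) : ℂ) = k - 1 := by rw [Nat.cast_sub (by omega)]; simp
  rw [h]
  congr 1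
  · congr 1 <;> congr 1 <;> push_cast <;> ring
  · split_ifs
    · rfl
    · congr 1; push_cast; ring

theorem genAstar_smul_str_matStar (x : X D) {k l ε n : ℕ}
    {u : EuclideanSpace ℂ (Finset (Fin D))}
    (hu : IsLowest k u) (h : k + ε = l) (i : Fin n) :
    genAstar D x • str x u ε i = ∑ j : Fin n, matStar D l n j i • str x u ε j := by
  rw [genAstar_smul_str x hu, h, Finset.sum_eq_single i]
  · simp [matStar]
  · intro j _ hj; simp [matStar, hj]
  · simp

/-- The index set of the basis of the standard module that the strings provide. -/
abbrev StrIdx (D : ℕ) : Type :=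
  (Σ k : IdxM D, Σ _ : Fin (mult D k), Fin (D / 2 - k + 1)) ⊕
    (Σ k : IdxN D, Σ _ : Fin (mult D ((k : ℕ) - 1)), Fin ((D + 1) / 2 - k + 1))

theorem card_strIdx (x : X D) : Fintype.card (StrIdx D) = Fintype.card (X D) := by
  rw [Fintype.card_congr (diffEquiv x), ← sum_mult_mul_dim]
  simp

end Pull

/-! ### The basis of the standard module -/

/-- The members of the strings that start from orthonormal lowest weight vectors are pairwise
orthogonal. -/
theorem orthogonal_strings {α : Type*} [Fintype α] [DecidableEq α] {N : ℕ → ℕ}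
    {u : ∀ k, Fin (N k) → EuclideanSpace ℂ (Finset α)} (hu : ∀ k, Orthonormal ℂ (u k))
    (hl : ∀ k m, IsLowest k (u k m)) {k l : ℕ} {m : Fin (N k)} {m' : Fin (N l)} {n n' : ℕ}
    (h : (⟨k, m, n⟩ : Σ k, Fin (N k) × ℕ) ≠ ⟨l, m', n'⟩) :
    inner ℂ (divPow (u k m) n) (divPow (u l m') n') = 0 := by
  by_cases hkl : k = l
  · subst hkl
    by_cases hm : m = m'
    · subst hm
      refine inner_eq_zero_of_mem_level ?_ (divPow_mem_level (hl k m).1 n)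
        (divPow_mem_level (hl k m).1 n')
      rintro hn
      exact h (by rw [Nat.add_left_cancel hn])
    · exact inner_divPow_eq_zero (hl k m) (hl k m') ((hu k).2 hm) n n'
  · exact inner_divPow_eq_zero (hl k m) (hl l m')
      (inner_eq_zero_of_mem_level hkl (hl k m).1 (hl l m').1) n n'

/-- The strings that start in an even level `k` contribute their members `2 i`, and those that
start in the odd level `k - 1` their members `2 i + 1`, because these lie in the even levels. -/
def strPos (D : ℕ) : StrIdx D → Σ k, Fin (mult D k) × ℕ
  | Sum.inl ⟨k, m, i⟩ => ⟨k, m, 2 * i⟩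
  | Sum.inr ⟨k, m, i⟩ => ⟨k - 1, m, 2 * i + 1⟩

theorem strPos_injective (D : ℕ) : Function.Injective (strPos D) := by
  rintro (⟨⟨k, hk⟩, m, i⟩ | ⟨⟨k, hk⟩, m, i⟩) (⟨⟨l, hl⟩, m', i'⟩ | ⟨⟨l, hl⟩, m', i'⟩) h <;>
    simp only [strPos, Sigma.mk.injEq] at h
  · obtain ⟨rfl, h⟩ := h
    simp only [heq_eq_eq, Prod.mk.injEq] at h
    obtain ⟨rfl, h⟩ := h
    have : i = i' := Fin.ext (by omega)
    rw [this]
  · exfalso; grind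
  · exfalso; grind
  · obtain ⟨h1, h⟩ := h
    obtain rfl : k = l := by omega
    simp only [heq_eq_eq, Prod.mk.injEq] at h
    obtain ⟨rfl, h⟩ := h
    have : i = i' := Fin.ext (by omega)
    rw [this]

/-- The even members of all strings form a basis of the standard module. -/
theorem exists_basis_standard {D : ℕ} (x : X D) :
    ∃ (u : ∀ k, Fin (mult D k) → EuclideanSpace ℂ (Finset (Fin D)))
      (B : Module.Basis (StrIdx D) ℂ (X D → ℂ)), (∀ k m, IsLowest k (u k m)) ∧
      (∀ (k : IdxM D) m i, B (Sum.inl ⟨k, m, i⟩) = str x (u k m) 0 i) ∧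
      (∀ (k : IdxN D) m i, B (Sum.inr ⟨k, m, i⟩) = str x (u ((k : ℕ) - 1) m) 1 i) := by
  have hex := exists_orthonormal_isLowest (Fin D)
  rw [Fintype.card_fin] at hex
  choose u hu hl using hex
  let v : StrIdx D → EuclideanSpace ℂ (Finset (Fin D)) := fun a =>
    divPow (u (strPos D a).1 (strPos D a).2.1) (strPos D a).2.2
  have hv : LinearIndependent ℂ v := by
    refine linearIndependent_of_ne_zero_of_inner_eq_zero (fun a => ?_) fun a b hab => ?_
    · refine divPow_ne_zero (hl _ _) ((hu _).ne_zero _) ?_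
      rw [Fintype.card_fin]
      rcases a with ⟨⟨k, hk⟩, m, i⟩ | ⟨⟨k, hk⟩, m, i⟩
      · have := i.2
        simp only [strPos] at this ⊢; omega
      · have := i.2
        simp only [strPos] at this ⊢; omega
    · exact orthogonal_strings hu hl fun h => hab (strPos_injective D h)
  have heven : ∀ a, Even ((strPos D a).1 + (strPos D a).2.2) := by
    rintro (⟨⟨k, hk⟩, m, i⟩ | ⟨⟨k, hk⟩, m, i⟩) <;> simp only [strPos] <;> grind
  have hpull : LinearIndependent ℂ fun a => pull x (v a) := by
    rw [Fintype.linearIndependent_iff] at hv ⊢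
    intro g hg
    refine hv g (pull_eq_zero x (fun S hS => ?_) (by simpa using hg))
    have h0 : ∀ a, v a S = 0 := fun a =>
      divPow_mem_level (hl _ _).1 _ S fun h => hS (h ▸ heven a)
    have : (∑ a, g a • v a) S = ∑ a, g a * v a S := by simp
    rw [this]
    exact Finset.sum_eq_zero fun a _ => by rw [h0, mul_zero]
  have hne : Nonempty (StrIdx D) := by
    rw [← Fintype.card_pos_iff, card_strIdx x]
    exact Fintype.card_pos_iff.2 ⟨x⟩
  refine ⟨u, basisOfLinearIndependentOfCardEqFinrank hpull ?_, hl, fun k m i => ?_,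
    fun k m i => ?_⟩
  · rw [card_strIdx x, Module.finrank_fintype_fun_eq_card]
  · rw [coe_basisOfLinearIndependentOfCardEqFinrank]; rfl
  · rw [coe_basisOfLinearIndependentOfCardEqFinrank]; rfl

theorem exists_basis_directSum {R : Type*} [Semiring R] {ι : Type*} [DecidableEq ι] {M : ι → Type*}
    [∀ i, AddCommMonoid (M i)] [∀ i, Module R (M i)] {η : ι → Type*}
    (b : ∀ i, Module.Basis (η i) R (M i)) :
    ∃ B : Module.Basis (Σ i, η i) R (⨁ i, M i), ∀ a, B a = DirectSum.of M a.1 (b a.1 a.2) := by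
  refine ⟨.mk (DFinsupp.linearIndependent_single (fun i => b i) fun i => (b i).linearIndependent)
    fun v _ => ?_, fun a => Module.Basis.mk_apply _ _ _⟩
  induction v using DirectSum.induction_on with
  | zero => exact Submodule.zero_mem _
  | add v w hv hw => exact Submodule.add_mem _ (hv trivial) (hw trivial)
  | of i v =>
    have h : ∀ w, w ∈ Submodule.span R (Set.range (b i)) → DirectSum.lof R ι M i w ∈
        Submodule.span R (Set.range fun a : Σ i, η i => DirectSum.of M a.1 (b a.1 a.2)) := by
      intro w hw
      induction hw using Submodule.span_induction with
      | mem w hw => obtain ⟨j, rfl⟩ := hw; exact Submodule.subset_span ⟨⟨i, j⟩, rfl⟩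
      | zero => rw [map_zero]; exact Submodule.zero_mem _
      | add v w _ _ hv hw => rw [map_add]; exact Submodule.add_mem _ hv hw
      | smul c v _ hv => rw [map_smul]; exact Submodule.smul_mem _ _ hv
    exact h v ((b i).mem_span v)

/-- A module on which the generators act by given matrices maps to any family on which they act by
the same formulas. -/
theorem exists_hom_of_basis {D : ℕ} {x : X D} {W W' : Type*} [AddCommGroup W] [Module ℂ W]
    [Module (T D x) W] [IsScalarTower ℂ (T D x) W] [AddCommGroup W'] [Module ℂ W']
    [Module (T D x) W'] [IsScalarTower ℂ (T D x) W'] {n : ℕ} (b : Module.Basis (Fin n) ℂ W)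
    {m ms : Matrix (Fin n) (Fin n) ℂ}
    (hA : LinearMap.toMatrix b b (Algebra.lsmul ℂ ℂ W (genA D x)) = m)
    (hAstar : LinearMap.toMatrix b b (Algebra.lsmul ℂ ℂ W (genAstar D x)) = ms) (f : Fin n → W')
    (hfA : ∀ i, genA D x • f i = ∑ j, m j i • f j)
    (hfAstar : ∀ i, genAstar D x • f i = ∑ j, ms j i • f j) :
    ∃ φ : W →ₗ[T D x] W', ∀ i, φ (b i) = f i := by
  let φ := b.constr ℂ f
  have hφ : ∀ i, φ (b i) = f i := b.constr_basis ℂ f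
  have h : ∀ (t : T D x) (m : Matrix (Fin n) (Fin n) ℂ),
      LinearMap.toMatrix b b (Algebra.lsmul ℂ ℂ W t) = m → (∀ i, t • f i = ∑ j, m j i • f j) →
      ∀ v, φ (t • v) = t • φ v := by
    intro t m hm hf v
    have : φ ∘ₗ Algebra.lsmul ℂ ℂ W t = Algebra.lsmul ℂ ℂ W' t ∘ₗ φ := by
      refine b.ext fun i => ?_
      change φ (t • b i) = t • φ (b i)
      rw [smul_basis_of_toMatrix b hm, map_sum, hφ, hf]
      exact Finset.sum_congr rfl fun j _ => by rw [map_smul, hφ]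
    exact LinearMap.congr_fun this v
  let ψ : W →ₗ[T D x] W' :=
    { toFun := φ
      map_add' := map_add φ
      map_smul' := map_smul_of_generators φ (h _ m hA hfA) (h _ ms hAstar hfAstar) }
  exact ⟨ψ, hφ⟩

theorem isSimpleModule_of_matM {D k : ℕ} {x : X D} {W : Type*} [AddCommGroup W] [Module ℂ W]
    [Module (T D x) W] [IsScalarTower ℂ (T D x) W] (hk : k ≤ D / 2)
    (b : Module.Basis (Fin (D / 2 - k + 1)) ℂ W)
    (hA : LinearMap.toMatrix b b (Algebra.lsmul ℂ ℂ W (genA D x)) = matM D k)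
    (hAstar : LinearMap.toMatrix b b (Algebra.lsmul ℂ ℂ W (genAstar D x)) = matStar D k _) :
    IsSimpleModule (T D x) W := by
  refine isSimpleModule_of_tridiag b (fun i _ => ?_) (fun i hi => ?_)
    (smul_basis_of_toMatrix b hA) (genAstar_smul_basis b hAstar)
  · exact mul_ne_zero (Nat.cast_add_one_ne_zero i)
      (by have := Nat.cast_add_one_ne_zero (R := ℂ) (2 * i); push_cast at this; exact this)
  · -- with `c = D - 2 (i + 1) - 2 k`, the entry is `(c + 1) (c + 2) / 2`
    obtain ⟨c, hc⟩ : ∃ c, D = 2 * (i + 1) + 2 * k + c := Nat.exists_eq_add_of_le (by omega)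
    have h1 := Nat.cast_add_one_ne_zero (R := ℂ) c
    have h2 := Nat.cast_add_one_ne_zero (R := ℂ) (c + 1)
    rw [hc]
    convert mul_ne_zero (mul_ne_zero (one_div_ne_zero (two_ne_zero (α := ℂ))) h1) h2 using 2
    · push_cast; ring
    · push_cast; ring

theorem isSimpleModule_of_matN {D k : ℕ} {x : X D} {W : Type*} [AddCommGroup W] [Module ℂ W]
    [Module (T D x) W] [IsScalarTower ℂ (T D x) W] (hk : k ≤ (D + 1) / 2)
    (b : Module.Basis (Fin ((D + 1) / 2 - k + 1)) ℂ W)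
    (hA : LinearMap.toMatrix b b (Algebra.lsmul ℂ ℂ W (genA D x)) = matN D k)
    (hAstar : LinearMap.toMatrix b b (Algebra.lsmul ℂ ℂ W (genAstar D x)) = matStar D k _) :
    IsSimpleModule (T D x) W := by
  refine isSimpleModule_of_tridiag b (fun i _ => ?_) (fun i hi => ?_)
    (smul_basis_of_toMatrix b hA) (genAstar_smul_basis b hAstar)
  · refine mul_ne_zero (Nat.cast_add_one_ne_zero i) ?_
    have := Nat.cast_add_one_ne_zero (R := ℂ) (2 * i + 2)
    push_cast at this
    convert this using 1; ring
  · -- with `c = D + 1 - 2 (i + 1) - 2 k`, the entry is `(c + 1) (c + 2) / 2`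
    obtain ⟨c, hc⟩ : ∃ c, D + 1 = 2 * (i + 1) + 2 * k + c := Nat.exists_eq_add_of_le (by omega)
    have hc' : (D : ℂ) = 2 * (i + 1) + 2 * k + c - 1 := by
      rw [eq_sub_iff_add_eq]; exact_mod_cast hc
    have h1 := Nat.cast_add_one_ne_zero (R := ℂ) c
    have h2 := Nat.cast_add_one_ne_zero (R := ℂ) (c + 1)
    rw [hc']
    convert mul_ne_zero (mul_ne_zero (one_div_ne_zero (two_ne_zero (α := ℂ))) h1) h2 using 2
    · push_cast; ring
    · push_cast; ring

end HalvedCube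

/-- The modules `M_k` and `N_k` exist, the numbers `(D-2k+1)/(D-k+1) * C(D,k)` and
`(D-2k+3)/(D-k+2) * C(D,k-1)` are natural numbers `p k` and `q k`, and, whatever copies of the
modules `M_k` and `N_k` are chosen, the standard module is isomorphic as a `T`-module to the
direct sum of `p k` copies of the `M_k` and `q k` copies of the `N_k`. -/
theorem theorem2p2 (D : ℕ) (hD : 3 ≤ D) (x : X D) :
    (∀ k : IdxM D, ∃ (W : Type) (_ : AddCommGroup W) (_ : Module ℂ W) (_ : Module (T D x) W)
      (_ : IsScalarTower ℂ (T D x) W), IsM D x k W) ∧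
    (∀ k : IdxN D, ∃ (W : Type) (_ : AddCommGroup W) (_ : Module ℂ W) (_ : Module (T D x) W)
      (_ : IsScalarTower ℂ (T D x) W), IsN D x k W) ∧
    ∃ (p : IdxM D → ℕ) (q : IdxN D → ℕ),
      (∀ k : IdxM D, (p k : ℚ) =
        ((D : ℚ) - 2 * (k : ℕ) + 1) / ((D : ℚ) - (k : ℕ) + 1) * (D.choose k : ℚ)) ∧
      (∀ k : IdxN D, (q k : ℚ) =
        ((D : ℚ) - 2 * (k : ℕ) + 3) / ((D : ℚ) - (k : ℕ) + 2) * (D.choose ((k : ℕ) - 1) : ℚ)) ∧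
      ∀ (M : IdxM D → Type*) [∀ k, AddCommGroup (M k)] [∀ k, Module ℂ (M k)]
        [∀ k, Module (T D x) (M k)] [∀ k, IsScalarTower ℂ (T D x) (M k)]
        (N : IdxN D → Type*) [∀ k, AddCommGroup (N k)] [∀ k, Module ℂ (N k)]
        [∀ k, Module (T D x) (N k)] [∀ k, IsScalarTower ℂ (T D x) (N k)],
        (∀ k : IdxM D, IsM D x k (M k)) → (∀ k : IdxN D, IsN D x k (N k)) →
          Nonempty ((X D → ℂ) ≃ₗ[T D x]
            (⨁ k : IdxM D, ⨁ _ : Fin (p k), M k) × (⨁ k : IdxN D, ⨁ _ : Fin (q k), N k)) := by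
  obtain ⟨u, B, hu, hM, hN⟩ := exists_basis_standard x
  have hMA : ∀ (k : IdxM D) (m : Fin (mult D k)) (i : Fin (D / 2 - k + 1)),
      genA D x • B (Sum.inl ⟨k, m, i⟩) = ∑ j, matM D k j i • B (Sum.inl ⟨k, m, j⟩) := by
    intro k m i
    simp only [hM]
    exact genA_smul_str_matM x (hu k m) k.2.2 i
  have hMs : ∀ (k : IdxM D) (m : Fin (mult D k)) (i : Fin (D / 2 - k + 1)),
      genAstar D x • B (Sum.inl ⟨k, m, i⟩) = ∑ j, matStar D k _ j i • B (Sum.inl ⟨k, m, j⟩) := by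
    intro k m i
    simp only [hM]
    exact genAstar_smul_str_matStar x (hu k m) rfl i
  have hNA : ∀ (k : IdxN D) (m : Fin (mult D ((k : ℕ) - 1))) (i : Fin ((D + 1) / 2 - k + 1)),
      genA D x • B (Sum.inr ⟨k, m, i⟩) = ∑ j, matN D k j i • B (Sum.inr ⟨k, m, j⟩) := by
    intro k m i
    simp only [hN]
    exact genA_smul_str_matN x (hu _ m) k.2.2.1 k.2.2.2 i
  have hNs : ∀ (k : IdxN D) (m : Fin (mult D ((k : ℕ) - 1))) (i : Fin ((D + 1) / 2 - k + 1)),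
      genAstar D x • B (Sum.inr ⟨k, m, i⟩) = ∑ j, matStar D k _ j i • B (Sum.inr ⟨k, m, j⟩) := by
    intro k m i
    simp only [hN]
    exact genAstar_smul_str_matStar x (hu _ m) (Nat.sub_add_cancel (by have := k.2.2.1; omega)) i
  refine ⟨fun k => ?_, fun k => ?_, fun k => mult D k, fun k => mult D ((k : ℕ) - 1),
    fun k => ?_, fun k => ?_, ?_⟩
  · have hk := k.2.2
    have hpos : 0 < mult D k := mult_pos (by omega)
    obtain ⟨S, b, hA, hs⟩ := exists_submodule_basis (fun i => B (Sum.inl ⟨k, ⟨0, hpos⟩, i⟩))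
      (B.linearIndependent.comp (fun i => Sum.inl ⟨k, ⟨0, hpos⟩, i⟩) fun i j h => by simpa using h)
      _ _ (hMA k _) (hMs k _)
    exact ⟨S, inferInstance, inferInstance, inferInstance, inferInstance,
      isSimpleModule_of_matM hk b hA hs, b, hA, hs⟩
  · have hk := k.2.2
    have hpos : 0 < mult D ((k : ℕ) - 1) := mult_pos (by omega)
    obtain ⟨S, b, hA, hs⟩ := exists_submodule_basis (fun i => B (Sum.inr ⟨k, ⟨0, hpos⟩, i⟩))
      (B.linearIndependent.comp (fun i => Sum.inr ⟨k, ⟨0, hpos⟩, i⟩) fun i j h => by simpa using h)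
      _ _ (hNA k _) (hNs k _)
    exact ⟨S, inferInstance, inferInstance, inferInstance, inferInstance,
      isSimpleModule_of_matN hk.2 b hA hs, b, hA, hs⟩
  · have hk := k.2.2
    exact mult_cast (by omega)
  · have hk := k.2.2
    rw [mult_cast (by omega), Nat.cast_sub (by omega)]
    congr 2 <;> push_cast <;> ring
  · intro M _ _ _ _ N _ _ _ _ hIM hIN
    choose _ bM hbMA hbMs using hIM
    choose _ bN hbNA hbNs using hIN
    choose φ hφ using fun k m => exists_hom_of_basis (bM k) (hbMA k) (hbMs k)
      (fun i => B (Sum.inl ⟨k, m, i⟩)) (hMA k m) (hMs k m)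
    choose ψ hψ using fun k m => exists_hom_of_basis (bN k) (hbNA k) (hbNs k)
      (fun i => B (Sum.inr ⟨k, m, i⟩)) (hNA k m) (hNs k m)
    obtain ⟨BM, hBM⟩ := exists_basis_directSum fun k : IdxM D =>
      (exists_basis_directSum fun _ : Fin (mult D k) => bM k).choose
    obtain ⟨BN, hBN⟩ := exists_basis_directSum fun k : IdxN D =>
      (exists_basis_directSum fun _ : Fin (mult D ((k : ℕ) - 1)) => bN k).choose
    let Φ : ((⨁ k : IdxM D, ⨁ _ : Fin (mult D k), M k) ×
        (⨁ k : IdxN D, ⨁ _ : Fin (mult D ((k : ℕ) - 1)), N k)) →ₗ[T D x] (X D → ℂ) :=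
      LinearMap.coprod
        (DirectSum.toModule _ _ _ fun k => DirectSum.toModule _ _ _ (φ k))
        (DirectSum.toModule _ _ _ fun k => DirectSum.toModule _ _ _ (ψ k))
    have hΦ : Φ.restrictScalars ℂ = ((BM.prod BN).equiv B (Equiv.refl _)).toLinearMap := by
      refine (BM.prod BN).ext fun a => ?_
      rw [LinearEquiv.coe_coe, Module.Basis.equiv_apply, Equiv.refl_apply,
        LinearMap.restrictScalars_apply]
      rcases a with ⟨k, m, i⟩ | ⟨k, m, i⟩
      · have h := (exists_basis_directSum fun _ : Fin (mult D k) => bM k).choose_spec ⟨m, i⟩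
        rw [← hφ, Module.Basis.prod_apply]
        change Φ (BM ⟨k, m, i⟩, 0) = _
        rw [LinearMap.coprod_apply, map_zero, add_zero, hBM, h]
        erw [DirectSum.toModule_lof, DirectSum.toModule_lof]
      · have h := (exists_basis_directSum
          fun _ : Fin (mult D ((k : ℕ) - 1)) => bN k).choose_spec ⟨m, i⟩
        rw [← hψ, Module.Basis.prod_apply]
        change Φ (0, BN ⟨k, m, i⟩) = _
        rw [LinearMap.coprod_apply, map_zero, zero_add, hBN, h]
        erw [DirectSum.toModule_lof, DirectSum.toModule_lof]
    have hbij : Function.Bijective Φ := by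
      have := ((BM.prod BN).equiv B (Equiv.refl _)).bijective
      rwa [← LinearEquiv.coe_coe, ← hΦ] at this
    exact ⟨(LinearEquiv.ofBijective Φ hbij).symm⟩
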